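/- Setting. Let $\mathbb F$ be a finite field and $n\ge 1$ an integer coprime to $|\mathbb F|$. Write $x^n-1=\pi_1\cdots\pi_r$ with pairwise distinct monic irreducible $\pi_k\in\mathbb F[x]$, put $A=\mathbb F[x]/(x^n-1)$, and let $\varepsilon_k\in A$ be the primitive idempotent with $\varepsilon_k\equiv\delta_{kj}\pmod{\pi_j}$ for all $j$. Fix $\sigma\in\mathrm{Aut}_{\mathbb F}(A)$; write $k\equiv_\sigma l$ if $\sigma^i(\varepsilon_k)=\varepsilon_l$ for some $i\ge 0$. Let $A[z;\sigma]$ be the ring of polynomials $\sum_j z^ja_j$ ($a_j\in A$) with usual addition and with multiplication determined by $az=z\sigma(a)$. Identify $\mathbb F[z]^n$ with $A[z;\sigma]$ via $\mathfrak p\big(\sum_j z^jv_j\big)=\sum_j z^j\big(\sum_{i=0}^{n-1}v_{j,i}x^i\big)$, $v_j=(v_{j,0},\dots,v_{j,n-1})\in\mathbb F^n$. Convolutional codes. A generator matrix of a submodule $\mathcal S\subseteq\mathbb F[z]^n$ of rank $k$ is a matrix $G\in\mathbb F[z]^{k\times n}$ whose rows form a basis of $\mathcal S$; the complexity $\delta(\mathcal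 S)$ is the maximal degree of a $k\times k$ minor of $G$ (independent of $G$). $G$ is minimal if its row degrees (maximal degree of an entry) add up to $\delta(\mathcal S)$; the multiset of row degrees of a minimal generator matrix is the multiset of Forney indices of $\mathcal S$. $\mathcal S$ is a convolutional code if it has a right invertible generator matrix (equivalently, is a direct summand of $\mathbb F[z]^n$). A $\sigma$-cyclic code is a convolutional code $\mathcal C\subseteq\mathbb F[z]^n$ for which $\mathfrak p(\mathcal C)$ is a left ideal of $A[z;\sigma]$. Minimal codes. For $f\in A[z;\sigma]$ put $f^{(k)}=\varepsilon_kf$ and $T_f=\{k: f^{(k)}\neq0\}$. The monomials $z^\mu\varepsilon_k$ are ordered lexicographically by $(\mu,k)$; the leading monomial of $f=\sum_\nu z^\nu f_\nu\ne0$ is the largest $z^\mu\varepsilon_k$ with $\varepsilon_kf_\mu\ne0$, and the elements $z^\nu\varepsilon_jf_\nu$ are the terms of $f$. Call $f$ reduced if for all $k\neq l$ no nonzero term of $f^{(k)}$ is right divisible by the leading monomial of $f^{(l)}$. A generator polynomial of a $\sigma$-cyclic code $\mathcal C$ is a reduced $g$ such that $\mathfrak p(\mathcal C)$ is the left ideal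 generated by $g$ (it is unique up to left multiplication by units of $A$); $T_g$ is the support of $\mathcal C$, and a nonzero $\mathcal C$ is minimal if $g=g^{(l)}$ for some $l$. Theorem. For $i=1,\dots,t$ let $\mathcal C_i\subseteq\mathbb F[z]^n$ be a minimal $\sigma$-cyclic code with support $\{l_i\}$, and assume $l_i\not\equiv_\sigma l_j$ for $i\ne j$. Then $\mathcal C:=\sum_{i=1}^t\mathcal C_i$ is a $\sigma$-cyclic code, the sum is direct, $\mathcal C=\bigoplus_{i=1}^t\mathcal C_i$, and $$\operatorname{rank}\mathcal C=\sum_{i=1}^t\operatorname{rank}\mathcal C_i=\sum_{i=1}^t\deg\pi_{l_i},\qquad \delta(\mathcal C)=\sum_{i=1}^t\delta(\mathcal C_i).$$ Moreover, each $\mathcal C_i$ has a minimal generator matrix, and the multiset of Forney indices of $\mathcal C$ is the union (with multiplicities added) of the multisets of Forney indices of $\mathcal C_1,\dots,\mathcal C_t$. -/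

import Mathlib

open Polynomial

namespace CyclicConv

/-! ### Submodules of `F[z]ⁿ`, generator matrices, complexity and Forney indices -/

section Convolutional

variable {F : Type*} [Field F] {n : ℕ}

/-- `G ∈ F[z]^{k × n}` is a generator matrix of `S ⊆ F[z]ⁿ`: its rows form a basis of `S`. -/
def IsGeneratorMatrix {k : ℕ} (G : Matrix (Fin k) (Fin n) F[X])
    (S : Submodule F[X] (Fin n → F[X])) : Prop :=
  LinearIndependent F[X] G.row ∧ Submodule.span F[X] (Set.range G.row) = S

/-- The maximal degree of a `k`-minor of a matrix with `k` rows. (Zero minors do not matter for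
matrices of rank `k`.) -/
noncomputable def minorDegree {k : ℕ} (G : Matrix (Fin k) (Fin n) F[X]) : ℕ :=
  Finset.univ.sup fun c : Fin k ↪o Fin n => (G.submatrix id c).det.natDegree

/-- A generator matrix of `S`, made from some basis of the free module `S`. -/
noncomputable def someGeneratorMatrix (S : Submodule F[X] (Fin n → F[X])) :
    Matrix (Fin (Module.finrank F[X] S)) (Fin n) F[X] :=
  Matrix.of fun i => (Module.finBasis F[X] S i : Fin n → F[X])

/-- The complexity of `S`: the maximal degree of the full-size minors of a generator matrix.
It does not depend on the generator matrix, see `complexity_eq`. -/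
noncomputable def complexity (S : Submodule F[X] (Fin n → F[X])) : ℕ :=
  minorDegree (someGeneratorMatrix S)

theorem isGeneratorMatrix_some (S : Submodule F[X] (Fin n → F[X])) :
    IsGeneratorMatrix (someGeneratorMatrix S) S := by
  have h : (someGeneratorMatrix S).row = S.subtype ∘ Module.finBasis F[X] S := rfl
  refine ⟨?_, ?_⟩
  · rw [h]
    exact (Module.finBasis F[X] S).linearIndependent.map' _ (Submodule.ker_subtype S)
  · rw [h, Set.range_comp, Submodule.span_image, (Module.finBasis F[X] S).span_eq]
    simp

theorem IsGeneratorMatrix.minorDegree_le {k : ℕ} {G G' : Matrix (Fin k) (Fin n) F[X]}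
    {S : Submodule F[X] (Fin n → F[X])} (h : IsGeneratorMatrix G S)
    (h' : IsGeneratorMatrix G' S) : minorDegree G ≤ minorDegree G' := by
  have key : ∀ {M N : Matrix (Fin k) (Fin n) F[X]}, IsGeneratorMatrix M S →
      IsGeneratorMatrix N S → ∃ V : Matrix (Fin k) (Fin k) F[X], M = V * N := by
    intro M N hM hN
    have : ∀ i, ∃ c : Fin k → F[X], ∑ j, c j • N.row j = M.row i := by
      intro i
      rw [← Submodule.mem_span_range_iff_exists_fun, hN.2, ← hM.2]
      exact Submodule.subset_span ⟨i, rfl⟩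
    choose V hV using this
    refine ⟨Matrix.of V, ?_⟩
    ext1 i j
    have := congrFun (hV i) j
    simp only [Finset.sum_apply, Pi.smul_apply, smul_eq_mul, Matrix.row] at this
    simp [Matrix.mul_apply, this]
  obtain ⟨V, hV⟩ := key h h'
  obtain ⟨W, hW⟩ := key h' h
  have hVW : V * W = 1 := by
    have e : (V * W) * G = (1 : Matrix (Fin k) (Fin k) F[X]) * G := by rw [Matrix.mul_assoc, ← hW, ← hV, Matrix.one_mul]
    have inj : Function.Injective fun v : Fin k → F[X] => Matrix.vecMul v G :=
      Matrix.vecMul_injective_iff.2 h.1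
    ext1 i j
    have e2 := congrFun e i
    rw [Matrix.mul_apply_eq_vecMul, Matrix.mul_apply_eq_vecMul] at e2
    exact congrFun (inj e2) j
  have hu : IsUnit V.det := by
    refine IsUnit.of_mul_eq_one W.det ?_
    rw [← Matrix.det_mul, hVW, Matrix.det_one]
  refine Finset.sup_le fun c _ => ?_
  have e : (G.submatrix id c).det = V.det * (G'.submatrix id c).det := by
    rw [← Matrix.det_mul, hV]
    rfl
  rw [e]
  refine natDegree_mul_le.trans ?_
  rw [natDegree_eq_zero_of_isUnit hu, zero_add]
  exact Finset.le_sup (f := fun c : Fin k ↪o Fin n => (G'.submatrix id c).det.natDegree)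
    (Finset.mem_univ c)

theorem complexity_eq {k : ℕ} {G : Matrix (Fin k) (Fin n) F[X]}
    {S : Submodule F[X] (Fin n → F[X])} (h : IsGeneratorMatrix G S) :
    complexity S = minorDegree G := by
  have hk : k = Module.finrank F[X] S := by
    have := finrank_span_eq_card h.1
    rw [h.2, Fintype.card_fin] at this
    exact this.symm
  subst hk
  exact le_antisymm ((isGeneratorMatrix_some S).minorDegree_le h)
    (h.minorDegree_le (isGeneratorMatrix_some S))

/-- The degree of a (nonzero) polynomial vector: the maximal degree of its entries. -/
def vecDegree (v : Fin n → F[X]) : ℕ :=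
  Finset.univ.sup fun i => (v i).natDegree

/-- A matrix of full row rank is minimal if its row degrees add up to its complexity. -/
def IsMinimalMatrix {k : ℕ} (G : Matrix (Fin k) (Fin n) F[X]) : Prop :=
  minorDegree G = ∑ i, vecDegree (G.row i)

/-- `m` is the multiset of Forney indices of `S`, i.e. the multiset of row degrees of a minimal
generator matrix of `S`. -/
def IsForneyIndices (S : Submodule F[X] (Fin n → F[X])) (m : Multiset ℕ) : Prop :=
  ∃ (k : ℕ) (G : Matrix (Fin k) (Fin n) F[X]), IsGeneratorMatrix G S ∧ IsMinimalMatrix G ∧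
    m = (Finset.univ : Finset (Fin k)).val.map fun i => vecDegree (G.row i)

/-- A convolutional code: a submodule having a right invertible generator matrix. -/
def IsConvolutionalCode (S : Submodule F[X] (Fin n → F[X])) : Prop :=
  ∃ (k : ℕ) (G : Matrix (Fin k) (Fin n) F[X]), IsGeneratorMatrix G S ∧
    ∃ G' : Matrix (Fin n) (Fin k) F[X], G * G' = 1

end Convolutional

/-! ### The Piret algebra -/

section Piret

/-- `A = F[x] / (xⁿ - 1)`. -/
abbrev A (F : Type*) [Field F] (n : ℕ) : Type _ :=
  F[X] ⧸ Ideal.span {(X ^ n - 1 : F[X])}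

variable {F : Type*} [Field F] {n : ℕ}

/-- The Piret algebra `A[z;σ]`. Its elements are the polynomials `∑ zʲ aⱼ` with coefficients
written on the right, its multiplication is determined by `a z = z σ(a)`. -/
def Piret (_σ : A F n ≃ₐ[F] A F n) : Type _ := (A F n)[X]

namespace Piret

variable (σ : A F n ≃ₐ[F] A F n)

noncomputable instance : AddCommGroup (Piret σ) := inferInstanceAs (AddCommGroup (A F n)[X])

/-- `zʲ a` -/
noncomputable def term (j : ℕ) (a : A F n) : Piret σ := (monomial j a : (A F n)[X])

variable {σ}

/-- The right coefficient of `zʲ`. -/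
noncomputable def coeff (f : Piret σ) (j : ℕ) : A F n := Polynomial.coeff (R := A F n) f j

/-- `(∑ zʲ aⱼ) (∑ zˡ bₗ) = ∑ zʲ⁺ˡ σˡ(aⱼ) bₗ` -/
noncomputable instance : Mul (Piret σ) where
  mul f g := Polynomial.sum (R := A F n) f fun j a => Polynomial.sum (R := A F n) g fun l b =>
    term σ (j + l) ((σ ^ l) a * b)

noncomputable instance : One (Piret σ) where
  one := term σ 0 1

theorem mul_def (f g : Piret σ) :
    f * g = Polynomial.sum (R := A F n) f fun j a => Polynomial.sum (R := A F n) g fun l b =>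
      term σ (j + l) ((σ ^ l) a * b) := rfl

theorem one_def : (1 : Piret σ) = term σ 0 1 := rfl

theorem term_add (j : ℕ) (a b : A F n) : term σ j (a + b) = term σ j a + term σ j b :=
  map_add (monomial (R := A F n) j) a b

theorem term_zero (j : ℕ) : term σ j 0 = 0 := map_zero (monomial (R := A F n) j)

theorem term_mul_term (j l : ℕ) (a b : A F n) :
    term σ j a * term σ l b = term σ (j + l) ((σ ^ l) a * b) := by
  rw [mul_def]
  refine (sum_monomial_index (S := Piret σ) a _ ?_).trans
    (sum_monomial_index (S := Piret σ) b _ ?_)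
  · simp [term_zero, Polynomial.sum]
  · simp [term_zero]

protected theorem add_mul (f g h : Piret σ) : (f + g) * h = f * h + g * h := by
  rw [mul_def, mul_def, mul_def]
  refine sum_add_index (S := Piret σ) _ _ _ ?_ ?_
  · simp [term_zero, Polynomial.sum]
  · intro j a b
    simp only [map_add, add_mul, term_add]
    exact sum_add' _ _ _

protected theorem mul_add (f g h : Piret σ) : f * (g + h) = f * g + f * h := by
  rw [mul_def, mul_def, mul_def]
  refine Eq.trans ?_ (sum_add' _ _ _)
  congr 1
  funext j a
  refine sum_add_index (S := Piret σ) _ _ _ ?_ ?_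
  · simp [term_zero]
  · intro l b c
    rw [mul_add, term_add]

protected theorem zero_mul (f : Piret σ) : 0 * f = 0 := by
  have := Piret.add_mul 0 0 f
  simpa using this

protected theorem mul_zero (f : Piret σ) : f * 0 = 0 := by
  have := Piret.mul_add f 0 0
  simpa using this

@[elab_as_elim]
theorem induction {P : Piret σ → Prop} (f : Piret σ) (add : ∀ f g, P f → P g → P (f + g))
    (term : ∀ j a, P (term σ j a)) : P f :=
  Polynomial.induction_on' (R := A F n) (motive := P) f add term

noncomputable instance : Ring (Piret σ) where
  __ := (inferInstance : AddCommGroup (Piret σ))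
  __ := (inferInstance : Mul (Piret σ))
  __ := (inferInstance : One (Piret σ))
  left_distrib := Piret.mul_add
  right_distrib := Piret.add_mul
  zero_mul := Piret.zero_mul
  mul_zero := Piret.mul_zero
  one_mul f := by
    induction f using induction with
    | add f g hf hg => rw [Piret.mul_add, hf, hg]
    | term j a => rw [one_def, term_mul_term]; simp
  mul_one f := by
    induction f using induction with
    | add f g hf hg => rw [Piret.add_mul, hf, hg]
    | term j a => rw [one_def, term_mul_term]; simp
  mul_assoc f g h := by
    induction f using induction with
    | add f f' hf hf' => simp only [Piret.add_mul, hf, hf']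
    | term j a =>
      induction g using induction with
      | add g g' hg hg' => simp only [Piret.add_mul, Piret.mul_add, hg, hg']
      | term l b =>
        induction h using induction with
        | add h h' hh hh' => simp only [Piret.mul_add, hh, hh']
        | term m c =>
          simp only [term_mul_term, map_mul]
          rw [add_assoc, mul_assoc, add_comm l m, pow_add, AlgEquiv.mul_apply]

end Piret

/-- The map `𝔭 : F[z]ⁿ → A[z;σ]`, sending `(v₀, …, vₙ₋₁)` to the polynomial whose right
coefficient at `zʲ` is `∑ᵢ vᵢⱼ xⁱ`, where `vᵢⱼ ∈ F` is the coefficient of `vᵢ` at `zʲ`. -/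
noncomputable def toPiret (σ : A F n ≃ₐ[F] A F n) (v : Fin n → F[X]) : Piret σ :=
  ∑ i : Fin n, (v i).sum fun j c => Piret.term σ j (Ideal.Quotient.mk _ (C c * X ^ (i : ℕ)))

/-- A submodule `S` of `F[z]ⁿ` is `σ`-cyclic if `𝔭(S)` is a left ideal of `A[z;σ]`. -/
def IsCyclicSubmodule (σ : A F n ≃ₐ[F] A F n) (S : Submodule F[X] (Fin n → F[X])) : Prop :=
  ∃ I : Ideal (Piret σ), toPiret σ '' S = I

/-- `σ`-cyclic convolutional codes. -/
def IsCyclicCode (σ : A F n ≃ₐ[F] A F n) (S : Submodule F[X] (Fin n → F[X])) : Prop :=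
  IsConvolutionalCode S ∧ (∃ D, IsCompl S D) ∧ IsCyclicSubmodule σ S

end Piret

/-! ### Prime factors, idempotents, reduced polynomials, minimal codes -/

/-- An enumeration `π₁, …, πᵣ` of the monic prime factors of the (square free) polynomial
`xⁿ - 1`. -/
structure PrimeFactors (F : Type*) [Field F] (n : ℕ) where
  r : ℕ
  π : Fin r → F[X]
  monic : ∀ k, (π k).Monic
  irreducible : ∀ k, Irreducible (π k)
  injective : Function.Injective π
  prod_eq : ∏ k, π k = X ^ n - 1

namespace PrimeFactors

variable {F : Type*} [Field F] {n : ℕ} (P : PrimeFactors F n)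

theorem isCoprime {k l : Fin P.r} (h : k ≠ l) : IsCoprime (P.π k) (P.π l) := by
  refine ((P.irreducible k).coprime_iff_not_dvd).2 fun hd => h ?_
  exact P.injective (eq_of_monic_of_associated (P.monic k) (P.monic l)
    ((P.irreducible k).associated_of_dvd (P.irreducible l) hd))

theorem span_eq : Ideal.span {(X ^ n - 1 : F[X])} = ⨅ k, Ideal.span {P.π k} := by
  rw [Ideal.iInf_span_singleton fun k l h => P.isCoprime h, P.prod_eq]

/-- The Chinese remainder isomorphism `ψ : A → K₁ × ⋯ × Kᵣ`, `K_k = F[x] / (π_k)`. -/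
noncomputable def crt : A F n ≃+* ∀ k, F[X] ⧸ Ideal.span {P.π k} :=
  (Ideal.quotEquivOfEq P.span_eq).trans (Ideal.quotientInfRingEquivPiQuotient _
    fun _ _ h => (Ideal.isCoprime_span_singleton_iff _ _).2 (P.isCoprime h))

/-- The primitive idempotent `ε_k = ψ⁻¹(0, …, 0, 1, 0, …, 0)`. -/
noncomputable def idem (k : Fin P.r) : A F n := P.crt.symm (Pi.single k 1)

variable (σ : A F n ≃ₐ[F] A F n)

/-- `k` and `l` lie in the same cycle of the permutation induced by `σ` on the idempotents. -/
def SameCycle (k l : Fin P.r) : Prop := ∃ i : ℕ, (σ ^ i) (P.idem k) = P.idem l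

variable {σ}

/-- The `k`-th component `f⁽ᵏ⁾ = ε_k f`. -/
noncomputable def component (k : Fin P.r) (f : Piret σ) : Piret σ :=
  Piret.term σ 0 (P.idem k) * f

/-- The support `T_f`. -/
def support (f : Piret σ) : Set (Fin P.r) := {k | P.component k f ≠ 0}

/-- `z^μ ε_k` is the leading monomial of `f`; monomials are ordered by `μ` first and then
by `k`. -/
def IsLeadingMonomial (f : Piret σ) (p : ℕ ×ₗ Fin P.r) : Prop :=
  IsGreatest {q : ℕ ×ₗ Fin P.r | P.idem (ofLex q).2 * f.coeff (ofLex q).1 ≠ 0} p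

/-- `f` is reduced: for `k ≠ l` no nonzero term `z^ν ε_j h_ν` of `h = f⁽ᵏ⁾` is right divisible by
the leading monomial of `f⁽ˡ⁾`. -/
def IsReduced (f : Piret σ) : Prop :=
  ∀ k l, k ≠ l → ∀ p, P.IsLeadingMonomial (P.component l f) p →
    ∀ ν j, P.idem j * (P.component k f).coeff ν ≠ 0 →
      ¬ ∃ h : Piret σ, Piret.term σ ν (P.idem j * (P.component k f).coeff ν) =
        h * Piret.term σ (ofLex p).1 (P.idem (ofLex p).2)

variable (σ)

/-- `g` is a reduced generator of the left ideal `𝔭(S)`. -/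
def IsGeneratorPolynomial (S : Submodule F[X] (Fin n → F[X])) (g : Piret σ) : Prop :=
  P.IsReduced g ∧ toPiret σ '' S = (Ideal.span {g} : Ideal (Piret σ))

/-- `S` has support `T`. -/
def HasSupport (S : Submodule F[X] (Fin n → F[X])) (T : Set (Fin P.r)) : Prop :=
  ∃ g : Piret σ, P.IsGeneratorPolynomial σ S g ∧ P.support g = T

/-- Minimal `σ`-cyclic codes: nonzero `σ`-cyclic codes whose generator polynomial is a
component. -/
def IsMinimalCode (S : Submodule F[X] (Fin n → F[X])) : Prop :=
  S ≠ ⊥ ∧ IsCyclicCode σ S ∧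
    ∃ g : Piret σ, P.IsGeneratorPolynomial σ S g ∧ ∃ l, g = P.component l g

end PrimeFactors

end CyclicConv

/-! For each `l i`, the sum `e i` of the idempotents in its σ-cycle is fixed by σ, hence central in
A[z;σ] (`exists_cycle_idem`). A code with support {l i} corresponds to the left ideal generated by
some g = ε_{l i} g, so multiplication by `e i` is the identity on `C i` and zero on every other `C
j`. Transported along 𝔭, it becomes an F[z]-endomorphism of F[z]ⁿ. These endomorphisms separate the
codes, which makes the sum direct, makes stacked generator matrices generator matrices, and lets
right inverses be glued (`isConvolutionalCode_iSup`).

For the complexity, ε_l A is a field, so an F-basis of it times g gives a generator matrix with deg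
π_l rows, all of the degree of g, with independent leading coefficient rows
(`exists_generatorMatrix`). Independent leading rows force the maximal degree of the minors to be
the sum of the row degrees (`minorDegree_eq_sum`). As `e i` is fixed by σ, it acts in the same way
on every z-coefficient, so it also separates the leading rows of different codes. The stacked matrix
therefore has independent leading rows, and complexities add. Once this is known, stacking arbitrary
minimal matrices gives a minimal matrix by counting degrees, which yields the Forney indices. -/

namespace CyclicConv

/-! ### Separation by endomorphisms; minors and leading coefficients. -/

section LinearAlgebra

/-- Families that are separated by endomorphisms are jointly linearly independent. -/
theorem linearIndependent_sigma_of_separated {R M ι : Type*} {κ : ι → Type*} [CommRing R]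
    [AddCommGroup M] [Module R M] [Fintype ι] [∀ i, Fintype (κ i)] (v : ∀ i, κ i → M)
    (hv : ∀ i, LinearIndependent R (v i)) (e : ι → M →ₗ[R] M)
    (he : ∀ i s, e i (v i s) = v i s) (he' : ∀ i j, i ≠ j → ∀ s, e i (v j s) = 0) :
    LinearIndependent R fun p : Σ i, κ i => v p.1 p.2 := by
  classical
  rw [Fintype.linearIndependent_iff]
  rintro c hc ⟨i, s⟩
  rw [Fintype.sum_sigma] at hc
  have h := congrArg (e i) hc
  rw [map_sum, map_zero, Finset.sum_eq_single i] at h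
  · simp only [map_sum, map_smul, he] at h
    exact Fintype.linearIndependent_iff.1 (hv i) (fun s => c ⟨i, s⟩) h s
  · intro j _ hj
    simp [he' i j hj.symm]
  · simp

/-- Submodules that are separated by endomorphisms are independent. -/
theorem iSupIndep_of_separated {R M ι : Type*} [CommRing R] [AddCommGroup M] [Module R M]
    (S : ι → Submodule R M) (e : ι → M →ₗ[R] M) (he : ∀ i, ∀ v ∈ S i, e i v = v)
    (he' : ∀ i j, i ≠ j → ∀ v ∈ S j, e i v = 0) : iSupIndep S := by
  intro i
  rw [Submodule.disjoint_def]
  intro x hx hx'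
  have h : ⨆ j, ⨆ (_ : j ≠ i), S j ≤ LinearMap.ker (e i) :=
    iSup₂_le fun j hj v hv => he' i j hj.symm v hv
  rw [← he i x hx]
  exact h hx'

/-- Row rank equals column rank, so some k columns form a basis of the column space; listing their
indices in increasing order gives the embedding. -/
theorem exists_orderEmb_det_ne_zero {K : Type*} [Field K] {k n : ℕ}
    {L : Matrix (Fin k) (Fin n) K} (hL : LinearIndependent K L.row) :
    ∃ c : Fin k ↪o Fin n, (L.submatrix id c).det ≠ 0 := by
  classical
  have hrank : L.rank = k := by simpa using hL.rank_matrix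
  obtain ⟨κ, a, ha, hspan, hli⟩ := exists_linearIndependent' K L.col
  have : Finite κ := Finite.of_injective a ha
  have := Fintype.ofFinite κ
  have hcard : Fintype.card κ = k := by
    rw [← finrank_span_eq_card hli, hspan, ← Matrix.rank_eq_finrank_span_cols, hrank]
  let T : Finset (Fin n) := Finset.univ.image a
  have hT : T.card = k := by rw [Finset.card_image_of_injective _ ha, Finset.card_univ, hcard]
  refine ⟨T.orderEmbOfFin hT, ?_⟩
  have hmem : ∀ i, ∃ x, a x = T.orderEmbOfFin hT i := fun i => by
    obtain ⟨x, -, hx⟩ := Finset.mem_image.1 (T.orderEmbOfFin_mem hT i)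
    exact ⟨x, hx⟩
  choose b hb using hmem
  have hbinj : Function.Injective b := fun i j h => by
    apply (T.orderEmbOfFin hT).injective
    rw [← hb, ← hb, h]
  have hcol : LinearIndependent K (L.submatrix id (T.orderEmbOfFin hT)).col := by
    have h : (L.submatrix id (T.orderEmbOfFin hT)).col = (L.col ∘ a) ∘ b := by
      funext i
      simp only [Function.comp_apply, hb]
      rfl
    rw [h]
    exact hli.comp b hbinj
  exact ((Matrix.isUnit_iff_isUnit_det _).1
    (Matrix.linearIndependent_cols_iff_isUnit.1 hcol)).ne_zero

variable {F : Type*} [Field F]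

theorem coeff_prod_sum_of_natDegree_le {ι : Type*} (s : Finset ι) (f : ι → F[X]) (d : ι → ℕ)
    (h : ∀ i ∈ s, (f i).natDegree ≤ d i) :
    (∏ i ∈ s, f i).coeff (∑ i ∈ s, d i) = ∏ i ∈ s, (f i).coeff (d i) := by
  classical
  induction s using Finset.induction_on with
  | empty => simp
  | insert a s ha ih =>
    have hs : ∀ i ∈ s, (f i).natDegree ≤ d i := fun i hi => h i (Finset.mem_insert_of_mem hi)
    rw [Finset.prod_insert ha, Finset.prod_insert ha, Finset.sum_insert ha, ← ih hs]
    exact coeff_mul_add_eq_of_natDegree_le (h a (Finset.mem_insert_self a s))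
      ((natDegree_prod_le s f).trans (Finset.sum_le_sum hs))

variable {k n : ℕ}

theorem coeff_det_of_natDegree_le (M : Matrix (Fin k) (Fin k) F[X]) (d : Fin k → ℕ)
    (h : ∀ i j, (M i j).natDegree ≤ d i) :
    M.det.coeff (∑ i, d i) = (Matrix.of fun i j => (M i j).coeff (d i)).det := by
  -- After transposing, each Leibniz product is indexed by rows, which is where the degree bounds
  -- live.
  rw [← Matrix.det_transpose, ← Matrix.det_transpose (Matrix.of _), Matrix.det_apply,
    Matrix.det_apply, finsetSum_coeff]
  refine Finset.sum_congr rfl fun τ _ => ?_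
  rw [coeff_smul]
  congr 1
  exact coeff_prod_sum_of_natDegree_le _ _ _ fun i _ => h i _

theorem natDegree_det_le_sum (M : Matrix (Fin k) (Fin k) F[X]) (d : Fin k → ℕ)
    (h : ∀ i j, (M i j).natDegree ≤ d i) : M.det.natDegree ≤ ∑ i, d i := by
  rw [← Matrix.det_transpose, Matrix.det_apply]
  refine natDegree_sum_le_of_forall_le _ _ fun τ _ => ?_
  refine (natDegree_smul_le _ _).trans ((natDegree_prod_le _ _).trans ?_)
  exact Finset.sum_le_sum fun i _ => h i _

/-- The matrix of the coefficients of the `i`-th row at degree `d i`. -/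
def leadingMatrix (G : Matrix (Fin k) (Fin n) F[X]) (d : Fin k → ℕ) :
    Matrix (Fin k) (Fin n) F :=
  Matrix.of fun i j => (G i j).coeff (d i)

section

variable {G : Matrix (Fin k) (Fin n) F[X]} {d : Fin k → ℕ} (h : ∀ i j, (G i j).natDegree ≤ d i)
  (hL : LinearIndependent F (leadingMatrix G d).row)
include h hL

theorem exists_coeff_minor_ne_zero : ∃ c : Fin k ↪o Fin n,
    (G.submatrix id c).det.coeff (∑ i, d i) ≠ 0 := by
  obtain ⟨c, hc⟩ := exists_orderEmb_det_ne_zero hL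
  refine ⟨c, ?_⟩
  rw [coeff_det_of_natDegree_le (G.submatrix id c) d fun i j => h i (c j)]
  exact hc

/-- The coefficient of a minor at the largest possible degree is the corresponding minor of the
leading matrix, and full row rank makes one of these nonzero. -/
theorem minorDegree_eq_sum : minorDegree G = ∑ i, d i := by
  refine le_antisymm (Finset.sup_le fun c _ => natDegree_det_le_sum _ d fun i j => h i (c j)) ?_
  obtain ⟨c, hc⟩ := exists_coeff_minor_ne_zero h hL
  exact (le_natDegree_of_ne_zero hc).trans
    (Finset.le_sup (f := fun c : Fin k ↪o Fin n => (G.submatrix id c).det.natDegree)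
      (Finset.mem_univ c))

theorem linearIndependent_row_of_leadingMatrix : LinearIndependent F[X] G.row := by
  obtain ⟨c, hc⟩ := exists_coeff_minor_ne_zero h hL
  have hdet : (G.submatrix id c).det ≠ 0 := fun h0 => hc (by rw [h0, coeff_zero])
  have := Matrix.linearIndependent_rows_of_det_ne_zero hdet
  exact LinearIndependent.of_comp (LinearMap.funLeft F[X] F[X] c) this

theorem vecDegree_row_eq (i : Fin k) : vecDegree (G.row i) = d i := by
  refine le_antisymm (Finset.sup_le fun j _ => h i j) ?_
  obtain ⟨j, hj⟩ := Function.ne_iff.1 (hL.ne_zero i)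
  exact (le_natDegree_of_ne_zero (p := G i j) hj).trans
    (Finset.le_sup (f := fun j => (G.row i j).natDegree) (Finset.mem_univ j))

theorem isMinimalMatrix_of_leadingMatrix : IsMinimalMatrix G := by
  rw [IsMinimalMatrix, minorDegree_eq_sum h hL]
  exact Finset.sum_congr rfl fun i _ => (vecDegree_row_eq h hL i).symm

end

end LinearAlgebra

/-! ### Stacking generator matrices -/

section Stack

variable {R : Type*} {n t : ℕ} {k : Fin t → ℕ}

/-- The matrix whose rows are the rows of the matrices `G i`. -/
def stack (G : ∀ i, Matrix (Fin (k i)) (Fin n) R) : Matrix (Fin (∑ i, k i)) (Fin n) R :=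
  Matrix.of fun s => G (finSigmaFinEquiv.symm s).1 (finSigmaFinEquiv.symm s).2

theorem stack_apply (G : ∀ i, Matrix (Fin (k i)) (Fin n) R) (p : Σ i, Fin (k i)) :
    stack G (finSigmaFinEquiv p) = G p.1 p.2 := by
  funext j
  simp only [stack, Matrix.of_apply]
  rw [finSigmaFinEquiv.symm_apply_apply]

/-- A general target monoid covers both sums of row degrees and multisets of row degrees, the latter
as sums of singletons. -/
theorem sum_stack {M : Type*} [AddCommMonoid M] (f : (Fin n → R) → M)
    (G : ∀ i, Matrix (Fin (k i)) (Fin n) R) :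
    ∑ s, f ((stack G).row s) = ∑ i, ∑ s, f ((G i).row s) := by
  rw [← Fintype.sum_sigma (fun p : Σ i, Fin (k i) => f ((G p.1).row p.2))]
  exact (Fintype.sum_equiv finSigmaFinEquiv _ _ fun p => by
    rw [Matrix.row, Matrix.row, stack_apply]).symm

theorem range_stack (G : ∀ i, Matrix (Fin (k i)) (Fin n) R) :
    Set.range (stack G).row = ⋃ i, Set.range (G i).row := by
  have h : (stack G).row ∘ finSigmaFinEquiv = fun p : Σ i, Fin (k i) => (G p.1).row p.2 :=
    funext fun p => stack_apply G p
  rw [← finSigmaFinEquiv.surjective.range_comp, h, Set.range_sigma_eq_iUnion_range]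

theorem linearIndependent_stack [CommRing R] (G : ∀ i, Matrix (Fin (k i)) (Fin n) R)
    (hG : ∀ i, LinearIndependent R (G i).row) (e : Fin t → (Fin n → R) →ₗ[R] (Fin n → R))
    (he : ∀ i s, e i (G i s) = G i s) (he' : ∀ i j, i ≠ j → ∀ s, e i (G j s) = 0) :
    LinearIndependent R (stack G).row := by
  rw [← linearIndependent_equiv finSigmaFinEquiv]
  have h : (stack G).row ∘ finSigmaFinEquiv = fun p : Σ i, Fin (k i) => G p.1 p.2 :=
    funext fun p => stack_apply G p
  rw [h]
  exact linearIndependent_sigma_of_separated G hG e he he'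

variable {F : Type*} [Field F]

theorem IsGeneratorMatrix.row_mem {m : ℕ} {G : Matrix (Fin m) (Fin n) F[X]}
    {S : Submodule F[X] (Fin n → F[X])} (h : IsGeneratorMatrix G S) (s : Fin m) : G s ∈ S := by
  rw [← h.2]
  exact Submodule.subset_span ⟨s, rfl⟩

theorem IsGeneratorMatrix.finrank_eq {m : ℕ} {G : Matrix (Fin m) (Fin n) F[X]}
    {S : Submodule F[X] (Fin n → F[X])} (h : IsGeneratorMatrix G S) :
    Module.finrank F[X] S = m := by
  have := finrank_span_eq_card h.1
  rwa [h.2, Fintype.card_fin] at this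

variable {C : Fin t → Submodule F[X] (Fin n → F[X])}
  {e : Fin t → (Fin n → F[X]) →ₗ[F[X]] (Fin n → F[X])}
  (he : ∀ i, ∀ v ∈ C i, e i v = v) (he' : ∀ i j, i ≠ j → ∀ v ∈ C j, e i v = 0)
include he he'

theorem isGeneratorMatrix_stack {G : ∀ i, Matrix (Fin (k i)) (Fin n) F[X]}
    (hG : ∀ i, IsGeneratorMatrix (G i) (C i)) : IsGeneratorMatrix (stack G) (⨆ i, C i) := by
  refine ⟨linearIndependent_stack G (fun i => (hG i).1) e (fun i s => he i _ ((hG i).row_mem s))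
    fun i j hij s => he' i j hij _ ((hG j).row_mem s), ?_⟩
  rw [range_stack, Submodule.span_iUnion]
  exact iSup_congr fun i => (hG i).2

/-- With `E i` the matrix of `e i`, the right inverse has the column blocks `E i * G' i`: inserting
`E j` after `G i` keeps the rows if i = j and kills them otherwise, so the off-diagonal blocks
vanish. -/
theorem isConvolutionalCode_iSup (hC : ∀ i, IsConvolutionalCode (C i)) :
    IsConvolutionalCode (⨆ i, C i) := by
  choose k G hG G' hG' using hC
  let E : Fin t → Matrix (Fin n) (Fin n) F[X] := fun i => (LinearMap.toMatrix' (e i)).transpose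
  have hE : ∀ i v, Matrix.vecMul v (E i) = e i v := fun i v => by
    rw [Matrix.vecMul_transpose, LinearMap.toMatrix'_mulVec]
  refine ⟨_, stack G, isGeneratorMatrix_stack he he' hG,
    (stack fun i => (E i * G' i).transpose).transpose, ?_⟩
  have key : ∀ p q : Σ i, Fin (k i),
      (G p.1 * (E q.1 * G' q.1)) p.2 q.2 = if p = q then 1 else 0 := by
    rintro ⟨i, s⟩ ⟨j, u⟩
    rw [← Matrix.mul_assoc, Matrix.mul_apply_eq_vecMul, Matrix.mul_apply_eq_vecMul, hE]
    by_cases hij : i = j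
    · subst hij
      rw [he i _ ((hG i).row_mem s), ← Matrix.mul_apply_eq_vecMul, hG' i, Matrix.one_apply]
      simp
    · rw [he' j i (Ne.symm hij) _ ((hG i).row_mem s)]
      simp [hij]
  ext1 a b
  obtain ⟨p, rfl⟩ := finSigmaFinEquiv.surjective a
  obtain ⟨q, rfl⟩ := finSigmaFinEquiv.surjective b
  rw [Matrix.one_apply, Matrix.mul_apply]
  simp only [Matrix.transpose_apply, stack_apply, finSigmaFinEquiv.injective.eq_iff, ← key]
  rw [Matrix.mul_apply]

end Stack

/-- The map v ↦ v G' G is a projection onto S; the complement is the kernel of v ↦ v G'. -/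
theorem IsConvolutionalCode.exists_isCompl {F : Type*} [Field F] {n : ℕ}
    {S : Submodule F[X] (Fin n → F[X])} (h : IsConvolutionalCode S) : ∃ D, IsCompl S D := by
  obtain ⟨k, G, hG, G', hG'⟩ := h
  refine ⟨LinearMap.ker G'.vecMulLinear, ?_⟩
  have hS : S = LinearMap.range G.vecMulLinear := by
    rw [← hG.2, range_vecMulLinear]
  have hinv : ∀ w, Matrix.vecMul (Matrix.vecMul w G) G' = w := fun w => by
    rw [Matrix.vecMul_vecMul, hG', Matrix.vecMul_one]
  rw [isCompl_iff, Submodule.disjoint_def, Submodule.codisjoint_iff_exists_add_eq, hS]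
  constructor
  · rintro _ ⟨w, rfl⟩ hw
    have : w = 0 := (hinv w).symm.trans hw
    rw [this, map_zero]
  · intro v
    refine ⟨Matrix.vecMul (Matrix.vecMul v G') G, v - Matrix.vecMul (Matrix.vecMul v G') G,
      ⟨_, rfl⟩, ?_, by abel⟩
    change Matrix.vecMul (v - Matrix.vecMul (Matrix.vecMul v G') G) G' = 0
    rw [Matrix.sub_vecMul, hinv, sub_self]

end CyclicConv

/-! ### The map 𝔭 as an isomorphism of F[z]-modules. -/

namespace CyclicConv

section

variable {F : Type*} [Field F] {n : ℕ}

/-- The basis `1, x, x², …` of `F[x] / (q)` for a monic polynomial `q`. -/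
noncomputable def quotientBasis {q : F[X]} (hq : q.Monic) :
    Module.Basis (Fin q.natDegree) F (F[X] ⧸ Ideal.span {q}) :=
  (AdjoinRoot.powerBasis' hq).basis

theorem quotientBasis_apply {q : F[X]} (hq : q.Monic) (i : Fin q.natDegree) :
    quotientBasis hq i = Ideal.Quotient.mk _ (X ^ (i : ℕ)) :=
  (AdjoinRoot.powerBasis' hq).basis_eq_pow i

theorem monic_X_pow_sub_one (hn : n ≠ 0) : (X ^ n - 1 : F[X]).Monic := by
  simpa using monic_X_pow_sub_C (1 : F) hn

theorem natDegree_X_pow_sub_one : (X ^ n - 1 : F[X]).natDegree = n := by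
  simpa using natDegree_X_pow_sub_C (n := n) (r := (1 : F))

/-- The basis `1, x, …, xⁿ⁻¹` of `A`. -/
noncomputable def xBasis (hn : n ≠ 0) : Module.Basis (Fin n) F (A F n) :=
  (quotientBasis (monic_X_pow_sub_one hn)).reindex (finCongr natDegree_X_pow_sub_one)

theorem xBasis_apply (hn : n ≠ 0) (i : Fin n) :
    xBasis (F := F) hn i = Ideal.Quotient.mk _ (X ^ (i : ℕ)) := by
  rw [xBasis, Module.Basis.reindex_apply]
  exact quotientBasis_apply _ _

theorem mk_C_mul (c : F) (p : F[X]) :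
    (Ideal.Quotient.mk _ (C c * p) : A F n) = c • Ideal.Quotient.mk _ p := by
  rw [← smul_eq_C_mul]
  rfl

variable {σ : A F n ≃ₐ[F] A F n}

theorem pow_apply_of_fixed {e : A F n} (he : σ e = e) (j : ℕ) : (σ ^ j) e = e := by
  induction j with
  | zero => rfl
  | succ j ih => rw [pow_succ, AlgEquiv.mul_apply, he, ih]

namespace Piret

/-- The coefficient map as an additive homomorphism. -/
noncomputable def coeffHom (σ : A F n ≃ₐ[F] A F n) (j : ℕ) : Piret σ →+ A F n :=
  (Polynomial.lcoeff (A F n) j).toAddMonoidHom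

theorem coeffHom_apply (f : Piret σ) (j : ℕ) : coeffHom σ j f = f.coeff j := rfl

theorem coeff_term (j : ℕ) (a : A F n) (m : ℕ) :
    (term σ j a).coeff m = if j = m then a else 0 := coeff_monomial

theorem ext_coeff {f g : Piret σ} (h : ∀ j, f.coeff j = g.coeff j) : f = g :=
  Polynomial.ext (R := A F n) h

/-- Moving a across zʲ applies σʲ, since a zʲ = zʲ σʲ(a). -/
theorem coeff_term_zero_mul (a : A F n) (f : Piret σ) (j : ℕ) :
    (term σ 0 a * f).coeff j = (σ ^ j) a * f.coeff j := by
  induction f using induction with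
  | add f g hf hg =>
    simp only [← coeffHom_apply, mul_add, map_add] at hf hg ⊢
    rw [hf, hg]
  | term l b =>
    rw [term_mul_term, coeff_term, coeff_term, zero_add]
    split_ifs with h
    · rw [h]
    · rw [mul_zero]

/-- Elements of `A` fixed by `σ` are central. -/
theorem term_zero_mul_comm {e : A F n} (he : σ e = e) (f : Piret σ) :
    term σ 0 e * f = f * term σ 0 e := by
  induction f using induction with
  | add f g hf hg => rw [mul_add, add_mul, hf, hg]
  | term j a =>
    rw [term_mul_term, term_mul_term, pow_apply_of_fixed he, zero_add, add_zero,
      pow_zero, AlgEquiv.one_apply, mul_comm]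

/-- The embedding `A → A[z;σ]`. -/
noncomputable def constHom (σ : A F n ≃ₐ[F] A F n) : A F n →+* Piret σ where
  toFun := term σ 0
  map_one' := rfl
  map_zero' := term_zero 0
  map_add' := term_add 0
  map_mul' a b := by rw [term_mul_term, pow_zero, AlgEquiv.one_apply, zero_add]

theorem constHom_apply (a : A F n) : constHom σ a = term σ 0 a := rfl

theorem term_one_pow (j : ℕ) : (term σ 1 1) ^ j = term σ j 1 := by
  induction j with
  | zero => rfl
  | succ j ih => rw [pow_succ, ih, term_mul_term, map_one, mul_one]

theorem commute_constHom_algebraMap (c : F) (f : Piret σ) :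
    Commute (((constHom σ).comp (algebraMap F (A F n))) c) f :=
  term_zero_mul_comm (AlgEquiv.commutes σ c) f

/-- The embedding `F[z] → A[z;σ]`. -/
noncomputable def polyHom (σ : A F n ≃ₐ[F] A F n) : F[X] →+* Piret σ :=
  eval₂RingHom' ((constHom σ).comp (algebraMap F (A F n))) (term σ 1 1) fun c =>
    commute_constHom_algebraMap c _

/-- In general z is not central, so this is only a left module structure: right multiplications are
linear, while left multiplication by a constant is linear when that constant is fixed by σ. -/
noncomputable instance : Module F[X] (Piret σ) := Module.compHom _ (polyHom σ)

theorem smul_def (p : F[X]) (f : Piret σ) : p • f = polyHom σ p * f := rfl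

instance : IsScalarTower F[X] (Piret σ) (Piret σ) :=
  ⟨fun p f g => by rw [smul_def, smul_def, smul_eq_mul, smul_eq_mul, mul_assoc]⟩

theorem monomial_smul_term (j : ℕ) (c : F) (l : ℕ) (a : A F n) :
    (monomial j c : F[X]) • term σ l a = term σ (j + l) (c • a) := by
  have h : polyHom σ (monomial j c) = term σ j (algebraMap F (A F n) c) := by
    rw [polyHom, eval₂RingHom'_apply, eval₂_monomial, term_one_pow, RingHom.comp_apply,
      constHom_apply, term_mul_term, AlgEquiv.commutes, mul_one, zero_add]
  rw [smul_def, h, term_mul_term, AlgEquiv.commutes]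
  exact congrArg (term σ (j + l)) (Algebra.smul_def c a).symm

theorem smul_term_zero (p : F[X]) (a : A F n) :
    p • term σ 0 a = p.sum fun j c => term σ j (c • a) := by
  conv_lhs => rw [p.as_sum_support, Finset.sum_smul]
  exact Finset.sum_congr rfl fun j _ => by rw [monomial_smul_term, add_zero]

/-- Left multiplication by an element fixed by `σ`, as an `F[z]`-linear map. -/
noncomputable def centralMul (e : A F n) (he : σ e = e) : Piret σ →ₗ[F[X]] Piret σ where
  toFun f := term σ 0 e * f
  map_add' := mul_add _
  map_smul' p f := by
    rw [smul_def, RingHom.id_apply, smul_def, ← mul_assoc, term_zero_mul_comm he, mul_assoc]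

end Piret

open Piret

theorem toPiret_eq_sum (v : Fin n → F[X]) :
    toPiret σ v = ∑ i, v i • term σ 0 (Ideal.Quotient.mk _ (X ^ (i : ℕ))) := by
  refine Finset.sum_congr rfl fun i _ => ?_
  rw [smul_term_zero]
  simp only [mk_C_mul]

theorem coeff_toPiret (v : Fin n → F[X]) (j : ℕ) : (toPiret σ v).coeff j =
    ∑ i, (v i).coeff j • (Ideal.Quotient.mk _ (X ^ (i : ℕ)) : A F n) := by
  rw [toPiret, ← coeffHom_apply, map_sum]
  refine Finset.sum_congr rfl fun i _ => ?_
  rw [Polynomial.sum, map_sum]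
  simp only [coeffHom_apply, coeff_term, mk_C_mul]
  rw [Finset.sum_ite_eq' (v i).support j]
  split_ifs with h
  · rfl
  · rw [notMem_support_iff.1 h, zero_smul]

theorem coeff_toPiret_eq (hn : n ≠ 0) (v : Fin n → F[X]) (j : ℕ) : (toPiret σ v).coeff j =
    (xBasis hn).equivFun.symm fun i => (v i).coeff j := by
  rw [coeff_toPiret, Module.Basis.equivFun_symm_apply]
  simp only [xBasis_apply]

/-- The map `𝔭` as an `F[z]`-linear map. -/
noncomputable def toPiretLinear (σ : A F n ≃ₐ[F] A F n) : (Fin n → F[X]) →ₗ[F[X]] Piret σ where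
  toFun := toPiret σ
  map_add' v w := by simp only [toPiret_eq_sum, Pi.add_apply, add_smul, Finset.sum_add_distrib]
  map_smul' p v := by
    simp only [toPiret_eq_sum, Pi.smul_apply, smul_eq_mul, mul_smul, Finset.smul_sum,
      RingHom.id_apply]

theorem toPiretLinear_injective (hn : n ≠ 0) : Function.Injective (toPiretLinear σ) := by
  intro v w h
  have hj : ∀ j, (fun i => (v i).coeff j) = fun i => (w i).coeff j := fun j => by
    apply (xBasis (F := F) hn).equivFun.symm.injective
    rw [← coeff_toPiret_eq (σ := σ), ← coeff_toPiret_eq (σ := σ)]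
    exact congrArg (fun f => f.coeff j) h
  funext i
  ext j
  exact congrFun (hj j) i

theorem toPiretLinear_surjective (hn : n ≠ 0) : Function.Surjective (toPiretLinear σ) := by
  intro f
  induction f using Piret.induction with
  | add f g hf hg =>
    obtain ⟨v, rfl⟩ := hf
    obtain ⟨w, rfl⟩ := hg
    exact ⟨v + w, map_add _ _ _⟩
  | term j a =>
    refine ⟨fun i => monomial j ((xBasis hn).equivFun a i), Piret.ext_coeff fun m => ?_⟩
    refine (coeff_toPiret_eq hn _ m).trans ?_
    rw [coeff_term]
    simp only [coeff_monomial]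
    split_ifs with h
    · exact (xBasis hn).equivFun.symm_apply_apply a
    · exact map_zero _

/-- The map `𝔭` as an `F[z]`-linear isomorphism. -/
noncomputable def toPiretEquiv (σ : A F n ≃ₐ[F] A F n) (hn : n ≠ 0) :
    (Fin n → F[X]) ≃ₗ[F[X]] Piret σ :=
  LinearEquiv.ofBijective (toPiretLinear σ)
    ⟨toPiretLinear_injective hn, toPiretLinear_surjective hn⟩

/-- Since 𝔭 is additive, closure under left multiplication need only be checked on elements of the
summands. -/
theorem IsCyclicSubmodule.iSup {ι : Sort*} {S : ι → Submodule F[X] (Fin n → F[X])}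
    (hS : ∀ i, IsCyclicSubmodule σ (S i)) : IsCyclicSubmodule σ (⨆ i, S i) := by
  refine ⟨{ carrier := toPiret σ '' (⨆ i, S i : Submodule F[X] (Fin n → F[X]))
            add_mem' := ?_
            zero_mem' := ⟨0, zero_mem _, map_zero (toPiretLinear σ)⟩
            smul_mem' := ?_ }, rfl⟩
  · rintro _ _ ⟨v, hv, rfl⟩ ⟨w, hw, rfl⟩
    exact ⟨v + w, add_mem hv hw, map_add (toPiretLinear σ) v w⟩
  · rintro h _ ⟨v, hv, rfl⟩
    rw [smul_eq_mul]
    induction hv using Submodule.iSup_induction' with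
    | mem i v hv =>
      obtain ⟨I, hI⟩ := hS i
      have : h * toPiret σ v ∈ (I : Set (Piret σ)) :=
        I.mul_mem_left h (hI.subset ⟨v, hv, rfl⟩)
      rw [← hI] at this
      exact Set.image_mono (le_iSup S i) this
    | zero =>
      refine ⟨0, zero_mem _, ?_⟩
      rw [show toPiret σ 0 = 0 from map_zero (toPiretLinear σ), mul_zero]
    | add v w _ _ hv hw =>
      obtain ⟨v', hv', e⟩ := hv
      obtain ⟨w', hw', e'⟩ := hw
      refine ⟨v' + w', add_mem hv' hw', ?_⟩
      rw [show toPiret σ (v + w) = toPiret σ v + toPiret σ w from map_add (toPiretLinear σ) v w,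
        mul_add, ← e, ← e']
      exact map_add (toPiretLinear σ) v' w'

end

end CyclicConv

/-! ### Primitive idempotents of A and their σ-cycles. -/

namespace CyclicConv

namespace PrimeFactors

variable {F : Type*} [Field F] {n : ℕ} (P : PrimeFactors F n)

theorem crt_mk (p : F[X]) (k : Fin P.r) :
    P.crt (Ideal.Quotient.mk _ p) k = Ideal.Quotient.mk _ p := rfl

theorem crt_smul (c : F) (a : A F n) : P.crt (c • a) = c • P.crt a := by
  obtain ⟨p, rfl⟩ := Ideal.Quotient.mk_surjective a
  rw [← mk_C_mul]
  funext k
  rw [crt_mk, Pi.smul_apply, crt_mk, ← smul_eq_C_mul]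
  rfl

/-- The embedding of the field `K_k = F[x] / (π_k)` into `A` as `ε_k A`. -/
noncomputable def fieldEmb (k : Fin P.r) : (F[X] ⧸ Ideal.span {P.π k}) →ₗ[F] A F n where
  toFun w := P.crt.symm (Pi.single k w)
  map_add' v w := by rw [Pi.single_add, map_add]
  map_smul' c w := by
    rw [RingEquiv.symm_apply_eq, RingHom.id_apply, crt_smul, RingEquiv.apply_symm_apply]
    funext j
    rcases eq_or_ne j k with rfl | h
    · simp
    · simp [h]

theorem fieldEmb_apply (k : Fin P.r) (w : F[X] ⧸ Ideal.span {P.π k}) :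
    P.fieldEmb k w = P.crt.symm (Pi.single k w) := rfl

theorem fieldEmb_one (k : Fin P.r) : P.fieldEmb k 1 = P.idem k := rfl

theorem fieldEmb_mul (k : Fin P.r) (v w : F[X] ⧸ Ideal.span {P.π k}) :
    P.fieldEmb k (v * w) = P.fieldEmb k v * P.fieldEmb k w := by
  simp only [fieldEmb_apply]
  rw [Pi.single_mul, map_mul]

/-- This identifies ε_k A with the field K_k: only the k-th Chinese remainder coordinate survives.
-/
theorem idem_mul (k : Fin P.r) (a : A F n) : P.idem k * a = P.fieldEmb k (P.crt a k) := by
  rw [fieldEmb_apply, RingEquiv.eq_symm_apply, map_mul, idem, RingEquiv.apply_symm_apply]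
  funext j
  rcases eq_or_ne j k with rfl | h
  · simp
  · simp [h]

theorem exists_mul_eq_one {k : Fin P.r} {w : F[X] ⧸ Ideal.span {P.π k}} (hw : w ≠ 0) :
    ∃ v, w * v = 1 := by
  have := PrincipalIdealRing.isMaximal_of_irreducible (P.irreducible k)
  exact Ideal.Quotient.exists_inv hw

theorem sum_idem : ∑ k, P.idem k = 1 := by
  simp only [idem]
  rw [← map_sum, Finset.univ_sum_single (fun k => (1 : F[X] ⧸ Ideal.span {P.π k}))]
  exact map_one P.crt.symm

theorem idem_mul_self (k : Fin P.r) : P.idem k * P.idem k = P.idem k := by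
  rw [← fieldEmb_one, ← fieldEmb_mul, mul_one]

/-- The idempotents `ε_k` are primitive. -/
theorem idem_mul_eq_zero_or_eq (k : Fin P.r) {f : A F n} (hf : f * f = f) :
    P.idem k * f = 0 ∨ P.idem k * f = P.idem k := by
  rw [idem_mul]
  set w := P.crt f k with hw
  have hww : w * w = w := by rw [hw, ← Pi.mul_apply, ← map_mul, hf]
  -- An idempotent of the field K_k is 0 or 1.
  rcases eq_or_ne w 0 with h | h
  · left
    rw [h, map_zero]
  · right
    obtain ⟨v, hv⟩ := P.exists_mul_eq_one h
    have : w = 1 := by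
      calc w = w * (w * v) := by rw [hv, mul_one]
        _ = 1 := by rw [← mul_assoc, hww, hv]
    rw [this, fieldEmb_one]

variable (σ : A F n ≃ₐ[F] A F n)

/-- An automorphism maps primitive idempotents to primitive idempotents, and two of these are equal
or orthogonal. Primitivity is applied twice: to ε_m, and to ε_k after pulling ε_m back by σʲ. -/
theorem pow_idem_mul_idem (j : ℕ) {k m : Fin P.r} (h : (σ ^ j) (P.idem k) ≠ P.idem m) :
    (σ ^ j) (P.idem k) * P.idem m = 0 := by
  have h1 : P.idem m * (σ ^ j) (P.idem k) = 0 ∨ P.idem m * (σ ^ j) (P.idem k) = P.idem m :=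
    P.idem_mul_eq_zero_or_eq m (by rw [← map_mul, idem_mul_self])
  rw [mul_comm]
  refine h1.resolve_right fun h2 => h ?_
  have h3 : P.idem k * (σ ^ j).symm (P.idem m) = 0 ∨
      P.idem k * (σ ^ j).symm (P.idem m) = P.idem k :=
    P.idem_mul_eq_zero_or_eq k (by rw [← map_mul, idem_mul_self])
  have h4 : (σ ^ j) (P.idem k * (σ ^ j).symm (P.idem m)) = P.idem m := by
    rw [map_mul, AlgEquiv.apply_symm_apply, mul_comm, h2]
  rcases h3 with h3 | h3
  · rw [h3, map_zero] at h4
    rw [← h4, zero_mul] at h2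
    have h5 : P.fieldEmb m 1 = P.fieldEmb m 0 := by rw [fieldEmb_one, map_zero, ← h4]
    have h6 := Pi.single_injective m (P.crt.symm.injective h5)
    have := PrincipalIdealRing.isMaximal_of_irreducible (P.irreducible m)
    exact absurd h6 (one_ne_zero' (F[X] ⧸ Ideal.span {P.π m}))
  · rw [← h4, h3]

/-- The sum of the idempotents in a cycle of `σ`. -/
theorem exists_cycle_idem [Finite F] (hn : n ≠ 0) (k : Fin P.r) :
    ∃ e : A F n, σ e = e ∧ e * P.idem k = P.idem k ∧
      ∀ m, ¬ P.SameCycle σ k m → e * P.idem m = 0 := by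
  have : Module.Finite F (A F n) := Module.Finite.of_basis (xBasis hn)
  have : Finite (A F n) := Module.finite_of_finite F
  -- A is finite, so σ has finite order.
  have : Finite (A F n ≃ₐ[F] A F n) := DFunLike.finite _
  obtain ⟨N, hN, hσ⟩ := (isOfFinOrder_of_finite σ).exists_pow_eq_one
  obtain ⟨N, rfl⟩ := Nat.exists_eq_succ_of_ne_zero hN.ne'
  -- Here σ^(N+1) = 1, so j may run through the cycle several times. A plain sum would count each
  -- idempotent repeatedly; the complementary product does not, and σ merely permutes its factors
  -- cyclically.
  refine ⟨1 - ∏ j ∈ Finset.range (N + 1), (1 - (σ ^ j) (P.idem k)), ?_, ?_, ?_⟩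
  · rw [map_sub, map_one, map_prod]
    congr 1
    rw [Finset.prod_range_succ, Finset.prod_range_succ']
    simp only [map_sub, map_one, ← AlgEquiv.mul_apply, ← pow_succ']
    rw [hσ, pow_zero]
  · rw [Finset.prod_range_succ', pow_zero, AlgEquiv.one_apply, sub_mul, mul_assoc, sub_mul,
      one_mul, idem_mul_self, sub_self, mul_zero, sub_zero]
  · intro m hm
    have : ∀ M : ℕ, (∏ j ∈ Finset.range M, (1 - (σ ^ j) (P.idem k))) * P.idem m = P.idem m := by
      intro M
      induction M with
      | zero => simp
      | succ M ih =>
        rw [Finset.prod_range_succ, mul_assoc, sub_mul, one_mul,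
          P.pow_idem_mul_idem σ M fun h => hm ⟨M, h⟩, sub_zero, ih]
    rw [sub_mul, one_mul, this, sub_self]

end PrimeFactors

open Piret

/-! ### Central elements acting on F[z]ⁿ coefficientwise. -/

section CentralProjection

variable {F : Type*} [Field F] {n : ℕ} {σ : A F n ≃ₐ[F] A F n} (hn : n ≠ 0)

/-- Multiplication by `e ∈ A` on coordinate vectors. -/
noncomputable def constMul (e : A F n) : (Fin n → F) →ₗ[F] (Fin n → F) :=
  (xBasis hn).equivFun.toLinearMap ∘ₗ LinearMap.mulLeft F e ∘ₗ
    (xBasis hn).equivFun.symm.toLinearMap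

/-- Multiplication by a central element `e ∈ A` on `F[z]ⁿ`. -/
noncomputable def polyMul (e : A F n) (he : σ e = e) : (Fin n → F[X]) →ₗ[F[X]] (Fin n → F[X]) :=
  (toPiretEquiv σ hn).symm.toLinearMap ∘ₗ centralMul e he ∘ₗ (toPiretEquiv σ hn).toLinearMap

theorem toPiret_polyMul (e : A F n) (he : σ e = e) (v : Fin n → F[X]) :
    toPiret σ (polyMul hn e he v) = term σ 0 e * toPiret σ v :=
  (toPiretEquiv σ hn).apply_symm_apply _

/-- As σʲ(e) = e, no twist depending on j appears. This is what carries separation over from the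
codes to their leading coefficient rows. -/
theorem coeff_polyMul (e : A F n) (he : σ e = e) (v : Fin n → F[X]) (j : ℕ) :
    (fun i => (polyMul hn e he v i).coeff j) = constMul hn e fun i => (v i).coeff j := by
  have h := coeff_toPiret_eq (σ := σ) hn (polyMul hn e he v) j
  rw [toPiret_polyMul, coeff_term_zero_mul, pow_apply_of_fixed he,
    coeff_toPiret_eq hn] at h
  exact ((LinearEquiv.eq_symm_apply _).1 h).symm

end CentralProjection

namespace PrimeFactors

variable {F : Type*} [Field F] {n : ℕ} (P : PrimeFactors F n) {σ : A F n ≃ₐ[F] A F n}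

/-- Since the ε_k sum to 1, g is the sum of its components, and only the l-th is nonzero. -/
theorem exists_generator_of_hasSupport {S : Submodule F[X] (Fin n → F[X])} {l : Fin P.r}
    (hS : P.HasSupport σ S {l}) : ∃ g : Piret σ, g ≠ 0 ∧ term σ 0 (P.idem l) * g = g ∧
      toPiret σ '' S = (Ideal.span {g} : Ideal (Piret σ)) := by
  obtain ⟨g, ⟨-, hg⟩, hT⟩ := hS
  refine ⟨g, ?_, ?_, hg⟩
  · rintro rfl
    have : l ∈ P.support (0 : Piret σ) := hT ▸ Set.mem_singleton l
    exact this (mul_zero _)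
  · have h : ∑ k, P.component k g = g := by
      calc ∑ k, P.component k g = (∑ k, constHom σ (P.idem k)) * g := (Finset.sum_mul ..).symm
        _ = g := by rw [← map_sum, sum_idem, map_one, one_mul]
    refine Eq.trans ?_ h
    refine (Finset.sum_eq_single (f := fun k => P.component k g) l (fun k _ hk => ?_) (by simp)).symm
    by_contra h0
    have : k ∈ P.support g := h0
    rw [hT] at this
    exact hk this

/-! ### Left ideals generated by a single component g = ε_l g. -/

section Generator

variable {S : Submodule F[X] (Fin n → F[X])} {l : Fin P.r} {g : Piret σ}
  (hg : term σ 0 (P.idem l) * g = g)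
  (hS : toPiret σ '' S = (Ideal.span {g} : Ideal (Piret σ)))
include hg hS

/-- Centrality moves e past the cofactor h, next to g = ε_l g, so its effect depends only on e ε_l.
-/
theorem polyMul_of_mem (hn : n ≠ 0) {e : A F n} (he : σ e = e) {v : Fin n → F[X]}
    (hv : v ∈ S) : ∃ h : Piret σ, toPiret σ v = h * g ∧
      toPiret σ (polyMul hn e he v) = h * (term σ 0 (e * P.idem l) * g) := by
  obtain ⟨h, hh⟩ := Ideal.mem_span_singleton'.1 (hS.subset ⟨v, hv, rfl⟩)
  refine ⟨h, hh.symm, ?_⟩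
  rw [toPiret_polyMul, ← hh, ← mul_assoc, term_zero_mul_comm he, mul_assoc, ← constHom_apply,
    ← constHom_apply, map_mul, mul_assoc, constHom_apply (P.idem l), hg]

theorem polyMul_eq_self (hn : n ≠ 0) {e : A F n} (he : σ e = e)
    (hel : e * P.idem l = P.idem l) {v : Fin n → F[X]} (hv : v ∈ S) :
    polyMul hn e he v = v := by
  obtain ⟨h, h1, h2⟩ := P.polyMul_of_mem hg hS hn he hv
  apply toPiretLinear_injective (σ := σ) hn
  refine h2.trans (Eq.trans ?_ h1.symm)
  rw [hel, hg]

theorem polyMul_eq_zero (hn : n ≠ 0) {e : A F n} (he : σ e = e)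
    (hel : e * P.idem l = 0) {v : Fin n → F[X]} (hv : v ∈ S) : polyMul hn e he v = 0 := by
  obtain ⟨h, h1, h2⟩ := P.polyMul_of_mem hg hS hn he hv
  apply toPiretLinear_injective (σ := σ) hn
  refine h2.trans (Eq.trans ?_ (map_zero _).symm)
  rw [hel, term_zero, zero_mul, mul_zero]

/-- A cyclic submodule generated by a nonzero `g = ε_l g` has a generator matrix with `deg π_l`
rows of the same degree, whose leading coefficients are linearly independent. -/
theorem exists_generatorMatrix (hn : n ≠ 0) (hg0 : g ≠ 0) :
    ∃ (d : ℕ) (G : Matrix (Fin (P.π l).natDegree) (Fin n) F[X]), IsGeneratorMatrix G S ∧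
      (∀ i j, (G i j).natDegree ≤ d) ∧
      LinearIndependent F (leadingMatrix G fun _ => d).row := by
  let d := natDegree (R := A F n) g
  have hgd : g.coeff d ≠ 0 := fun h => hg0 (leadingCoeff_eq_zero.1 h)
  have hgd' : ∀ m, d < m → g.coeff m = 0 := fun m hm =>
    coeff_eq_zero_of_natDegree_lt (R := A F n) hm
  let B := quotientBasis (P.monic l)
  let G : Matrix (Fin (P.π l).natDegree) (Fin n) F[X] := Matrix.of fun s =>
    (toPiretEquiv σ hn).symm (term σ 0 (P.fieldEmb l (B s)) * g)
  have hG : ∀ s, toPiret σ (G s) = term σ 0 (P.fieldEmb l (B s)) * g := fun s =>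
    (toPiretEquiv σ hn).apply_symm_apply _
  have hcoeff : ∀ s m, (fun j => (G s j).coeff m) =
      (xBasis hn).equivFun ((σ ^ m) (P.fieldEmb l (B s)) * g.coeff m) := fun s m => by
    rw [← coeff_term_zero_mul, ← hG, coeff_toPiret_eq hn, LinearEquiv.apply_symm_apply]
  have hdeg : ∀ i j, (G i j).natDegree ≤ d := fun i j => by
    rw [natDegree_le_iff_coeff_eq_zero]
    intro m hm
    have := congrFun (hcoeff i m) j
    rwa [hgd' m hm, mul_zero, map_zero] at this
  -- The leading rows are the images of the basis `B` under w ↦ σᵈ(w) g_d. This is injective: if w ≠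
  -- 0 killed g_d, multiplying by its inverse in K_l would give g_d = σᵈ(ε_l) g_d = 0.
  let f : (F[X] ⧸ Ideal.span {P.π l}) →ₗ[F] (Fin n → F) :=
    (xBasis hn).equivFun.toLinearMap ∘ₗ LinearMap.mulRight F (g.coeff d) ∘ₗ
      (σ ^ d).toLinearMap ∘ₗ P.fieldEmb l
  have hf : LinearMap.ker f = ⊥ := by
    refine LinearMap.ker_eq_bot'.2 fun w hw => ?_
    by_contra hw0
    have h1 : (σ ^ d) (P.fieldEmb l w) * g.coeff d = 0 :=
      (xBasis hn).equivFun.injective (hw.trans (map_zero _).symm)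
    obtain ⟨v, hv⟩ := P.exists_mul_eq_one hw0
    apply hgd
    rw [← hg, coeff_term_zero_mul, ← fieldEmb_one, ← hv, mul_comm w v, fieldEmb_mul, map_mul,
      mul_assoc, h1, mul_zero]
  have hL : LinearIndependent F (leadingMatrix G fun _ => d).row := by
    have h : (leadingMatrix G fun _ => d).row = f ∘ B := funext fun s => hcoeff s d
    rw [h]
    exact B.linearIndependent.map' f hf
  refine ⟨d, G, ⟨linearIndependent_row_of_leadingMatrix hdeg hL, le_antisymm ?_ ?_⟩, hdeg, hL⟩
  · rw [Submodule.span_le]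
    rintro _ ⟨s, rfl⟩
    have h : toPiret σ (G s) ∈ (Ideal.span {g} : Ideal (Piret σ)) := by
      rw [hG]
      exact Ideal.mul_mem_left _ _ (Ideal.mem_span_singleton_self g)
    obtain ⟨v, hv, hvs⟩ := hS.superset h
    rwa [toPiretLinear_injective hn hvs] at hv
  -- Because g = ε_l g, zʲ a g depends only on ε_l a, which expands in the F-basis of ε_l A; the
  -- coordinates times zʲ are the F[z]-coefficients of the rows.
  · have hT : ∀ f : Piret σ, ∃ v ∈ Submodule.span F[X] (Set.range G.row),
        toPiretLinear σ v = f * g := by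
      intro f
      induction f using Piret.induction with
      | add f f' hf hf' =>
        obtain ⟨v, hv, e⟩ := hf
        obtain ⟨v', hv', e'⟩ := hf'
        exact ⟨v + v', add_mem hv hv', by rw [map_add, e, e', add_mul]⟩
      | term j a =>
        refine ⟨∑ s, (monomial j (B.repr (P.crt a l) s) : F[X]) • G.row s, Submodule.sum_mem _
          fun s _ => Submodule.smul_mem _ _ (Submodule.subset_span ⟨s, rfl⟩), ?_⟩
        have h1 : term σ j a * g = term σ j (P.idem l * a) * g := by
          conv_lhs => rw [← hg, ← mul_assoc, term_mul_term, pow_zero, AlgEquiv.one_apply,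
            add_zero, mul_comm a]
        have h2 : P.idem l * a = ∑ s, B.repr (P.crt a l) s • P.fieldEmb l (B s) := by
          rw [idem_mul]
          conv_lhs => rw [← B.sum_repr (P.crt a l), map_sum]
          simp only [map_smul]
        have h3 : ∀ s, toPiretLinear σ (G.row s) = term σ 0 (P.fieldEmb l (B s)) * g := hG
        rw [h1, h2, map_sum]
        have h4 : term σ j (∑ s, B.repr (P.crt a l) s • P.fieldEmb l (B s)) =
            ∑ s, term σ j (B.repr (P.crt a l) s • P.fieldEmb l (B s)) :=
          map_sum (monomial (R := A F n) j).toAddMonoidHom _ _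
        rw [h4, Finset.sum_mul]
        refine Finset.sum_congr rfl fun s _ => ?_
        rw [map_smul, h3, ← smul_eq_mul, ← smul_assoc, monomial_smul_term, add_zero, smul_eq_mul]
    intro v hv
    obtain ⟨f, hf⟩ := Ideal.mem_span_singleton'.1 (hS.subset ⟨v, hv, rfl⟩)
    obtain ⟨v', hv', e⟩ := hT f
    rwa [toPiretLinear_injective hn (e.trans hf)] at hv'

end Generator

end PrimeFactors

end CyclicConv

/-! ### Assembling the codes. -/

theorem mainTheorem3 {F : Type*} [Field F] [Finite F] (n : ℕ) (hn : n.Coprime (Nat.card F))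
    (P : CyclicConv.PrimeFactors F n) (σ : CyclicConv.A F n ≃ₐ[F] CyclicConv.A F n)
    (t : ℕ) (l : Fin t → Fin P.r) (hl : ∀ i j, i ≠ j → ¬ P.SameCycle σ (l i) (l j))
    (C : Fin t → Submodule F[X] (Fin n → F[X]))
    (hmin : ∀ i, P.IsMinimalCode σ (C i)) (hsupp : ∀ i, P.HasSupport σ (C i) {l i}) :
    CyclicConv.IsCyclicCode σ (⨆ i, C i) ∧
    Module.finrank F[X] ↥(⨆ i, C i) = ∑ i, Module.finrank F[X] (C i) ∧
    Module.finrank F[X] ↥(⨆ i, C i) = ∑ i, (P.π (l i)).natDegree ∧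
    CyclicConv.complexity (⨆ i, C i) = ∑ i, CyclicConv.complexity (C i) ∧
    iSupIndep C ∧
    (∀ i, ∃ m, CyclicConv.IsForneyIndices (C i) m) ∧
    (∀ m : Fin t → Multiset ℕ, (∀ i, CyclicConv.IsForneyIndices (C i) (m i)) →
      CyclicConv.IsForneyIndices (⨆ i, C i) (∑ i, m i)) := by
  open CyclicConv in
  have hn0 : n ≠ 0 := by
    rintro rfl
    exact Finite.one_lt_card.ne' (Nat.coprime_zero_left _ |>.1 hn)
  choose g hg0 hg hS using fun i => P.exists_generator_of_hasSupport (hsupp i)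
  choose e he hel hel' using fun i => P.exists_cycle_idem σ hn0 (l i)
  let E : Fin t → (Fin n → F[X]) →ₗ[F[X]] (Fin n → F[X]) := fun i => polyMul hn0 (e i) (he i)
  have hE : ∀ i, ∀ v ∈ C i, E i v = v := fun i v hv =>
    P.polyMul_eq_self (hg i) (hS i) hn0 (he i) (hel i) hv
  have hE' : ∀ i j, i ≠ j → ∀ v ∈ C j, E i v = 0 := fun i j hij v hv =>
    P.polyMul_eq_zero (hg j) (hS j) hn0 (he i) (hel' i _ (hl i j hij)) hv
  choose d G hG hdeg hL using fun i => P.exists_generatorMatrix (hg i) (hS i) hn0 (hg0 i)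
  have hGC := isGeneratorMatrix_stack hE hE' hG
  have hconv : IsConvolutionalCode (⨆ i, C i) :=
    isConvolutionalCode_iSup hE hE' fun i => (hmin i).2.1.1
  have hcompl : complexity (⨆ i, C i) = ∑ i, complexity (C i) := by
    let D : Fin (∑ i, (P.π (l i)).natDegree) → ℕ := fun s => d (finSigmaFinEquiv.symm s).1
    -- The leading matrix of the stack is the stack of the leading matrices, whose blocks are
    -- separated over F by the same idempotents.
    have hLs : LinearIndependent F (leadingMatrix (stack G) D).row := by
      refine linearIndependent_stack (fun i => leadingMatrix (G i) fun _ => d i) hL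
        (fun i => constMul hn0 (e i)) (fun i s => ?_) fun i j hij s => ?_
      · refine (coeff_polyMul hn0 (e i) (he i) (G i s) (d i)).symm.trans ?_
        rw [show polyMul hn0 (e i) (he i) (G i s) = G i s from hE i _ ((hG i).row_mem s)]
        rfl
      · refine (coeff_polyMul hn0 (e i) (he i) (G j s) (d j)).symm.trans ?_
        rw [show polyMul hn0 (e i) (he i) (G j s) = 0 from hE' i j hij _ ((hG j).row_mem s)]
        rfl
    rw [complexity_eq hGC, minorDegree_eq_sum (G := stack G) (d := D) (fun s j => hdeg _ _ _) hLs]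
    rw [← Fintype.sum_equiv finSigmaFinEquiv
      (fun p : Σ i, Fin (P.π (l i)).natDegree => d p.1) D fun p => by
        simp only [D, Equiv.symm_apply_apply], Fintype.sum_sigma]
    exact Finset.sum_congr rfl fun i _ => by
      rw [complexity_eq (hG i), minorDegree_eq_sum (hdeg i) (hL i)]
  refine ⟨⟨hconv, hconv.exists_isCompl, IsCyclicSubmodule.iSup fun i => (hmin i).2.1.2.2⟩,
    ?_, hGC.finrank_eq, hcompl, iSupIndep_of_separated C E hE hE', fun i => ?_, fun m hm => ?_⟩
  · rw [hGC.finrank_eq]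
    exact Finset.sum_congr rfl fun i _ => (hG i).finrank_eq.symm
  · exact ⟨_, _, G i, hG i, isMinimalMatrix_of_leadingMatrix (hdeg i) (hL i), rfl⟩
  · choose k H hH hHmin hHm using hm
    have hHC := isGeneratorMatrix_stack hE hE' hH
    refine ⟨_, stack H, hHC, ?_, ?_⟩
    -- Additivity of the complexity is already known, so minimality of each `H i` suffices and its
    -- leading coefficients need not be examined.
    · rw [IsMinimalMatrix, ← complexity_eq hHC, hcompl, sum_stack vecDegree H]
      exact Finset.sum_congr rfl fun i _ => (complexity_eq (hH i)).trans (hHmin i)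
    · have key : ∀ {q : ℕ} (f : Fin q → ℕ),
          (Finset.univ : Finset (Fin q)).val.map f = ∑ s, ({f s} : Multiset ℕ) := fun f => by
        rw [← Multiset.sum_map_singleton (Multiset.map f _), Multiset.map_map]
        rfl
      rw [key, sum_stack (fun v => ({vecDegree v} : Multiset ℕ)) H]
      exact Finset.sum_congr rfl fun i _ => by rw [hHm i, key]
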